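/- For a positive integer $\ell$, let $\mathrm{Harm}_\ell(\mathbb R^4)$ be the real vector space of polynomials $P\in\mathbb R[x_1,x_2,x_3,x_4]$ that are homogeneous of degree $\ell$ and satisfy $\sum_{i=1}^4 \partial^2 P/\partial x_i^2=0$. For a finite set $X\subset\mathbb R^4$, the harmonic strength of $X$ is the set of positive integers $$T(X)=\Bigl\{\ell\ge 1 \;\Big|\; \sum_{x\in X}P(x)=0 \text{ for all } P\in \mathrm{Harm}_\ell(\mathbb R^4)\Bigr\}.$$ Theorem. Let $X$ be a non-empty finite subset of the unit sphere $\mathbb S^3\subset\mathbb R^4$ that is antipodal, that is, $-x\in X$ for every $x\in X$. (i) If $T(X)\supset\{10,4,2\}$, then $|X|\ge 24$. (ii) If $T(X)\supset\{14,10,6,4,2\}$, then $|X|\ge 48$. (iii) If $T(X)\supset\{10,8,6,4,2\}$, then $|X|\ge 120$. -/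

import Mathlib

namespace SphericalDesign

/-- The Laplacian `∑ i, ∂² / ∂x_i²` on real polynomials in `d` variables. -/
noncomputable def laplacian (d : ℕ) :
    MvPolynomial (Fin d) ℝ →ₗ[ℝ] MvPolynomial (Fin d) ℝ :=
  ∑ i : Fin d,
    (MvPolynomial.pderiv i).toLinearMap ∘ₗ (MvPolynomial.pderiv i).toLinearMap

/-- `Harm_ℓ(ℝ^d)`: the real polynomials in `d` variables that are homogeneous of degree `ℓ`
and harmonic. -/
noncomputable def Harm (d ℓ : ℕ) : Submodule ℝ (MvPolynomial (Fin d) ℝ) :=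
  MvPolynomial.homogeneousSubmodule (Fin d) ℝ ℓ ⊓ LinearMap.ker (laplacian d)

/-- The harmonic strength `T(X)` of a finite set `X ⊆ ℝ^d`: the positive integers `ℓ` such that
every harmonic polynomial that is homogeneous of degree `ℓ` sums to zero over `X`. -/
def harmonicStrength {d : ℕ} (X : Finset (EuclideanSpace ℝ (Fin d))) : Set ℕ :=
  {ℓ : ℕ | 0 < ℓ ∧ ∀ P ∈ Harm d ℓ, ∑ x ∈ X, MvPolynomial.eval (fun i => x i) P = 0}

/-- A finite set is antipodal if it contains the antipode of each of its points. -/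
def IsAntipodal {d : ℕ} (X : Finset (EuclideanSpace ℝ (Fin d))) : Prop :=
  ∀ x ∈ X, -x ∈ X

end SphericalDesign

namespace SphericalDesign

open MvPolynomial

/-! ### Differential operators and the Fischer pairing -/

section Polynomials

variable {d : ℕ}

/-! This is Delsarte's linear programming bound. Take f = a + ∑ c_k U_k with f ≥ 0 on [-1,1], f(-1)
= f(1), and each k in T(X) or c_k ≤ 0; sum f(⟨x,y⟩) over X × X. Each double sum of U_k is
nonnegative (`sum_chebyshevU_nonneg`) and vanishes for k in T(X), so the total is at most a|X|². The
pairs (y, ±y) alone give 2f(1)|X|. Hence 2f(1) ≤ a|X| (`two_mul_le_mul_card`), and three explicit f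
finish. -/

theorem laplacian_apply (P : MvPolynomial (Fin d) ℝ) :
    laplacian d P = ∑ i, pderiv i (pderiv i P) := by
  simp [laplacian]

/-- The linear form `x ↦ ∑ i, y i * x i`. -/
noncomputable def linForm (y : Fin d → ℝ) : MvPolynomial (Fin d) ℝ := ∑ i, C (y i) * X i

/-- The squared norm `∑ i, x i ^ 2` as a polynomial. -/
noncomputable def normSq (d : ℕ) : MvPolynomial (Fin d) ℝ := ∑ i, X i ^ 2

/-- The derivative in the direction `y`. -/
noncomputable def dirDeriv (y : Fin d → ℝ) :
    Derivation ℝ (MvPolynomial (Fin d) ℝ) (MvPolynomial (Fin d) ℝ) := ∑ i, y i • pderiv i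

theorem dirDeriv_apply (y : Fin d → ℝ) (P : MvPolynomial (Fin d) ℝ) :
    dirDeriv y P = ∑ i, y i • pderiv i P := by
  have := congrFun (map_sum (Derivation.coeFnAddMonoidHom (R := ℝ) (A := MvPolynomial (Fin d) ℝ)
    (M := MvPolynomial (Fin d) ℝ)) (fun i => y i • pderiv i) Finset.univ) P
  rw [Finset.sum_apply] at this
  exact this

theorem pderiv_linForm (y : Fin d → ℝ) (i : Fin d) : pderiv i (linForm y) = C (y i) := by
  simp [linForm, pderiv_X, Pi.single_apply]

theorem pderiv_normSq (i : Fin d) : pderiv i (normSq d) = 2 * X i := by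
  simp [normSq, pderiv_X, Pi.single_apply]

theorem isHomogeneous_linForm (y : Fin d → ℝ) : (linForm y).IsHomogeneous 1 :=
  IsHomogeneous.sum _ _ _ fun _ _ => isHomogeneous_C_mul_X _ _

theorem isHomogeneous_normSq : (normSq d).IsHomogeneous 2 :=
  IsHomogeneous.sum _ _ _ fun _ _ => isHomogeneous_X_pow _ _

theorem pderiv_comm (i j : Fin d) (P : MvPolynomial (Fin d) ℝ) :
    pderiv i (pderiv j P) = pderiv j (pderiv i P) := by
  rcases eq_or_ne i j with rfl | hij
  · rfl
  · ext α
    simp only [coeff_pderiv, Finsupp.add_apply, Finsupp.single_eq_of_ne hij,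
      Finsupp.single_eq_of_ne hij.symm, add_zero, add_right_comm α (Finsupp.single i 1)]
    ring

theorem laplacian_linForm_mul (y : Fin d → ℝ) (P : MvPolynomial (Fin d) ℝ) :
    laplacian d (linForm y * P) = 2 * dirDeriv y P + linForm y * laplacian d P := by
  simp only [laplacian_apply, dirDeriv_apply, Finset.mul_sum, ← Finset.sum_add_distrib]
  refine Finset.sum_congr rfl fun i _ => ?_
  simp only [Derivation.leibniz, map_add, pderiv_linForm, pderiv_C, smul_eq_mul, smul_eq_C_mul]
  ring

theorem laplacian_normSq_mul {n : ℕ} {P : MvPolynomial (Fin d) ℝ} (hP : P.IsHomogeneous n) :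
    laplacian d (normSq d * P) = (2 * d + 4 * n : ℕ) • P + normSq d * laplacian d P := by
  have h1 : ∀ i, pderiv i (pderiv i (normSq d * P)) =
      2 * P + 4 * (X i * pderiv i P) + normSq d * pderiv i (pderiv i P) := by
    intro i
    have h2 : pderiv i (2 : MvPolynomial (Fin d) ℝ) = 0 := by
      exact_mod_cast (pderiv (R := ℝ) i).map_natCast 2
    simp only [Derivation.leibniz, map_add, pderiv_normSq, smul_eq_mul, pderiv_X_self, h2]
    ring
  simp only [laplacian_apply, h1, Finset.sum_add_distrib, ← Finset.mul_sum,
    hP.sum_X_mul_pderiv, Finset.sum_const, Finset.card_univ, Fintype.card_fin, nsmul_eq_mul]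
  push_cast
  ring

theorem laplacian_dirDeriv (y : Fin d → ℝ) (P : MvPolynomial (Fin d) ℝ) :
    laplacian d (dirDeriv y P) = dirDeriv y (laplacian d P) := by
  simp only [laplacian_apply, dirDeriv_apply, map_sum, Derivation.map_smul]
  rw [Finset.sum_comm]
  refine Finset.sum_congr rfl fun i _ => Finset.sum_congr rfl fun j _ => ?_
  rw [pderiv_comm j i, pderiv_comm j i]

theorem isHomogeneous_dirDeriv (y : Fin d → ℝ) {n : ℕ} {P : MvPolynomial (Fin d) ℝ}
    (hP : P.IsHomogeneous n) : (dirDeriv y P).IsHomogeneous (n - 1) := by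
  rw [dirDeriv_apply]
  exact IsHomogeneous.sum _ _ _ fun i _ => by
    rw [smul_eq_C_mul]; simpa using (isHomogeneous_C (Fin d) (y i)).mul hP.pderiv

theorem eval_dirDeriv_self (y : Fin d → ℝ) {n : ℕ} {P : MvPolynomial (Fin d) ℝ}
    (hP : P.IsHomogeneous n) : eval y (dirDeriv y P) = n * eval y P := by
  have := congrArg (eval y) hP.sum_X_mul_pderiv
  simpa [dirDeriv_apply, smul_eval] using this

/-- The Fischer pairing `⟨P, Q⟩ = ∑ α, α! P_α Q_α`. -/
noncomputable def fischer (d : ℕ) :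
    MvPolynomial (Fin d) ℝ →ₗ[ℝ] MvPolynomial (Fin d) ℝ →ₗ[ℝ] ℝ :=
  (basisMonomials (Fin d) ℝ).constr ℝ fun α => (∏ i, ((α i).factorial : ℝ)) • lcoeff ℝ α

theorem fischer_monomial (α : Fin d →₀ ℕ) (c : ℝ) (Q : MvPolynomial (Fin d) ℝ) :
    fischer d (monomial α c) Q = c * ((∏ i, ((α i).factorial : ℝ)) * coeff α Q) := by
  have h : monomial α c = c • basisMonomials (Fin d) ℝ α := by simp [smul_monomial]
  rw [h, map_smul, fischer, Module.Basis.constr_basis]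
  simp

theorem fischer_self_nonneg (P : MvPolynomial (Fin d) ℝ) : 0 ≤ fischer d P P := by
  have h : fischer d P P =
      ∑ α ∈ P.support, coeff α P * ((∏ i, ((α i).factorial : ℝ)) * coeff α P) := by
    nth_rewrite 1 [P.as_sum]
    rw [map_sum, LinearMap.sum_apply]
    exact Finset.sum_congr rfl fun α _ => fischer_monomial _ _ _
  rw [h]
  refine Finset.sum_nonneg fun α _ => ?_
  have : 0 ≤ ∏ i, ((α i).factorial : ℝ) := Finset.prod_nonneg fun i _ => by positivity
  nlinarith [mul_nonneg this (mul_self_nonneg (coeff α P))]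

/-- Raising α_i by one multiplies the weight α! by α_i + 1, exactly the factor produced by
differentiation. -/
theorem fischer_X_mul (i : Fin d) (P Q : MvPolynomial (Fin d) ℝ) :
    fischer d (X i * P) Q = fischer d P (pderiv i Q) := by
  induction P using MvPolynomial.induction_on' with
  | add p q hp hq => simp [mul_add, hp, hq]
  | monomial α c =>
    have hX : X i * monomial α c = monomial (α + Finsupp.single i 1) c := by
      rw [X, monomial_mul, one_mul, add_comm]
    have hf : ∏ j, (((α + Finsupp.single i 1 : Fin d →₀ ℕ) j).factorial : ℝ) =
        (α i + 1) * ∏ j, ((α j).factorial : ℝ) := by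
      rw [← Finset.mul_prod_erase _ _ (Finset.mem_univ i),
        ← Finset.mul_prod_erase (a := i) _ (fun j => ((α j).factorial : ℝ)) (Finset.mem_univ i),
        ← mul_assoc]
      congr 1
      · simp [Nat.factorial_succ]
      · refine Finset.prod_congr rfl fun j hj => ?_
        simp [(Finset.ne_of_mem_erase hj).symm]
    rw [hX, fischer_monomial, fischer_monomial, hf, coeff_pderiv]
    ring

theorem fischer_linForm_mul (y : Fin d → ℝ) (P Q : MvPolynomial (Fin d) ℝ) :
    fischer d (linForm y * P) Q = fischer d P (dirDeriv y Q) := by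
  simp [linForm, dirDeriv_apply, Finset.sum_mul, ← smul_eq_C_mul, fischer_X_mul]

theorem fischer_normSq_mul (P Q : MvPolynomial (Fin d) ℝ) :
    fischer d (normSq d * P) Q = fischer d P (laplacian d Q) := by
  simp [normSq, laplacian_apply, Finset.sum_mul, sq, mul_assoc, fischer_X_mul]

end Polynomials

/-! ### Zonal harmonics and Chebyshev polynomials -/

/-- The zonal harmonic of degree `n` with pole `y` on `ℝ⁴`, normalised to restrict to the sphere as
the Chebyshev polynomial of the second kind in `⟪x, y⟫`. -/
noncomputable def zonal (y : Fin 4 → ℝ) : ℕ → MvPolynomial (Fin 4) ℝ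
  | 0 => 1
  | 1 => 2 * linForm y
  | n + 2 => 2 * (linForm y * zonal y (n + 1)) - normSq 4 * zonal y n

theorem isHomogeneous_zonal (y : Fin 4 → ℝ) (n : ℕ) : (zonal y n).IsHomogeneous n := by
  have h2 : ∀ {k : ℕ} {P : MvPolynomial (Fin 4) ℝ}, P.IsHomogeneous k →
      (2 * P).IsHomogeneous k := fun {k P} hP => by
    rw [two_mul]; exact hP.add hP
  induction n using Nat.twoStepInduction with
  | zero => exact isHomogeneous_one _ _
  | one => exact h2 (isHomogeneous_linForm y)
  | more n h0 h1 =>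
    refine (h2 ?_).sub ?_
    · simpa [add_comm, add_left_comm] using (isHomogeneous_linForm y).mul h1
    · simpa [add_comm] using (isHomogeneous_normSq (d := 4)).mul h0

theorem dirDeriv_linForm {y : Fin 4 → ℝ} (hy : ∑ i, y i ^ 2 = 1) : dirDeriv y (linForm y) = 1 := by
  have : ∑ i, y i • C (σ := Fin 4) (y i) = C (∑ i, y i ^ 2) := by
    simp [smul_eq_C_mul, sq]
  simp only [dirDeriv_apply, pderiv_linForm, this, hy, C_1]

theorem dirDeriv_normSq (y : Fin 4 → ℝ) : dirDeriv y (normSq 4) = 2 * linForm y := by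
  simp only [dirDeriv_apply, pderiv_normSq, linForm, Finset.mul_sum, smul_eq_C_mul]
  exact Finset.sum_congr rfl fun i _ => by ring

theorem dirDeriv_two (y : Fin 4 → ℝ) : dirDeriv y (2 : MvPolynomial (Fin 4) ℝ) = 0 := by
  exact_mod_cast (dirDeriv y).map_natCast 2

theorem dirDeriv_zonal {y : Fin 4 → ℝ} (hy : ∑ i, y i ^ 2 = 1) (n : ℕ) :
    dirDeriv y (zonal y (n + 1)) = (n + 2) * zonal y n := by
  induction n using Nat.twoStepInduction with
  | zero => simp [zonal, Derivation.leibniz, dirDeriv_two, dirDeriv_linForm hy]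
  | one =>
    simp only [zonal, Derivation.leibniz, map_sub, dirDeriv_two, dirDeriv_linForm hy,
      dirDeriv_normSq, smul_eq_mul, Derivation.map_one_eq_zero]
    push_cast
    ring
  | more n h0 h1 =>
    have e1 : zonal y (n + 2) = 2 * (linForm y * zonal y (n + 1)) - normSq 4 * zonal y n := rfl
    have e3 : zonal y (n + 2 + 1) =
      2 * (linForm y * zonal y (n + 2)) - normSq 4 * zonal y (n + 1) := rfl
    rw [e3]
    simp only [Derivation.leibniz, map_sub, dirDeriv_two, dirDeriv_linForm hy,
      dirDeriv_normSq, smul_eq_mul, h0, h1]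
    push_cast
    rw [e1]
    ring

theorem laplacian_zonal {y : Fin 4 → ℝ} (hy : ∑ i, y i ^ 2 = 1) (n : ℕ) :
    laplacian 4 (zonal y n) = 0 := by
  have h2 : ∀ P, laplacian 4 (2 * P) = 2 * laplacian 4 P := fun P => by
    rw [two_mul, map_add, two_mul]
  have h1 : laplacian 4 1 = 0 := by simp [laplacian_apply]
  induction n using Nat.twoStepInduction with
  | zero => exact h1
  | one =>
    have := laplacian_linForm_mul y 1
    rw [mul_one, h1] at this
    simp [zonal, h2, this]
  | more n h0 h1 =>
    have e1 : zonal y (n + 2) = 2 * (linForm y * zonal y (n + 1)) - normSq 4 * zonal y n := rfl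
    -- Dimension 4 enters here: 2·2(n+2) cancels 2·4 + 4n.
    rw [e1, map_sub, h2, laplacian_linForm_mul, h1, dirDeriv_zonal hy,
      laplacian_normSq_mul (isHomogeneous_zonal y n), h0, nsmul_eq_mul]
    push_cast
    ring

theorem zonal_mem_Harm {y : Fin 4 → ℝ} (hy : ∑ i, y i ^ 2 = 1) (n : ℕ) :
    zonal y n ∈ Harm 4 n :=
  ⟨isHomogeneous_zonal y n, laplacian_zonal hy n⟩

/-- The reproducing property of the zonal harmonics for the Fischer pairing. -/
theorem fischer_zonal (y : Fin 4 → ℝ) (n : ℕ) :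
    ∀ P ∈ Harm 4 n, fischer 4 (zonal y n) P = 2 ^ n * n.factorial * eval y P := by
  have h2 : ∀ P Q, fischer 4 (2 * P) Q = 2 * fischer 4 P Q := fun P Q => by
    rw [two_mul, map_add, two_mul]; rfl
  have hD : ∀ {k P}, P ∈ Harm 4 (k + 1) → dirDeriv y P ∈ Harm 4 k := fun {k P} hP =>
    ⟨isHomogeneous_dirDeriv y hP.1, by
      have : laplacian 4 P = 0 := hP.2
      change laplacian 4 (dirDeriv y P) = 0
      rw [laplacian_dirDeriv, this, map_zero]⟩
  have hone : ∀ P ∈ Harm 4 0, fischer 4 1 P = eval y P := fun P hP => by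
    have hc : P = C (coeff 0 P) := totalDegree_eq_zero_iff_eq_C.1
      (Nat.le_zero.1 (IsHomogeneous.totalDegree_le hP.1))
    rw [hc]
    simpa using fischer_monomial (0 : Fin 4 →₀ ℕ) 1 (C (coeff 0 P))
  induction n using Nat.twoStepInduction with
  | zero => intro P hP; simpa [zonal] using hone P hP
  | one =>
    intro P hP
    have e1 : zonal y 1 = 2 * (linForm y * 1) := by simp [zonal]
    rw [e1, h2, fischer_linForm_mul, hone _ (hD hP), eval_dirDeriv_self y hP.1]
    simp
  | more n h0 h1 =>
    intro P hP
    have e1 : zonal y (n + 2) = 2 * (linForm y * zonal y (n + 1)) - normSq 4 * zonal y n := rfl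
    have hl : laplacian 4 P = 0 := hP.2
    -- The `normSq` term drops out because its adjoint, the Laplacian, kills P; Euler's identity
    -- supplies the factor n + 2.
    rw [e1, map_sub, LinearMap.sub_apply, h2, fischer_linForm_mul, fischer_normSq_mul, hl,
      map_zero, h1 _ (hD hP), eval_dirDeriv_self y hP.1, Nat.factorial_succ (n + 1)]
    push_cast
    ring

/-- The Chebyshev polynomials of the second kind, as functions. -/
def chebyshevU : ℕ → ℝ → ℝ
  | 0, _ => 1
  | 1, t => 2 * t
  | n + 2, t => 2 * (t * chebyshevU (n + 1) t) - chebyshevU n t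

theorem chebyshevU_add_four (n : ℕ) (t : ℝ) :
    chebyshevU (n + 4) t = (4 * t ^ 2 - 2) * chebyshevU (n + 2) t - chebyshevU n t := by
  simp only [chebyshevU]
  ring

theorem eval_zonal {x : Fin 4 → ℝ} (y : Fin 4 → ℝ) (hx : ∑ i, x i ^ 2 = 1) (n : ℕ) :
    eval x (zonal y n) = chebyshevU n (∑ i, y i * x i) := by
  induction n using Nat.twoStepInduction with
  | zero => simp [zonal, chebyshevU]
  | one => simp [zonal, chebyshevU, linForm]
  | more n h0 h1 => simp [zonal, chebyshevU, h0, h1, linForm, normSq, hx]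

/-! ### The linear programming bound -/

section Sphere

variable {X : Finset (EuclideanSpace ℝ (Fin 4))}

theorem sum_sq_eq_one (hX : (X : Set (EuclideanSpace ℝ (Fin 4))) ⊆ Metric.sphere 0 1) :
    ∀ x ∈ X, ∑ i, x i ^ 2 = 1 := fun x hx => by
  have h : ‖x‖ = 1 := by simpa using hX hx
  rw [← EuclideanSpace.real_norm_sq_eq, h, one_pow]

/-- By the reproducing property, the double sum is a positive multiple of the Fischer square of the
sum of the zonal harmonics with poles in X. -/
theorem sum_chebyshevU_nonneg (hX : ∀ x ∈ X, ∑ i, x i ^ 2 = 1) (n : ℕ) :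
    0 ≤ ∑ y ∈ X, ∑ x ∈ X, chebyshevU n (∑ i, y i * x i) := by
  set S : MvPolynomial (Fin 4) ℝ := ∑ y ∈ X, zonal (fun i => y i) n with hS
  have h : fischer 4 S S =
      2 ^ n * n.factorial * ∑ y ∈ X, ∑ x ∈ X, chebyshevU n (∑ i, y i * x i) := by
    rw [Finset.mul_sum, hS, map_sum]
    refine Finset.sum_congr rfl fun y hy => ?_
    rw [map_sum, LinearMap.sum_apply, Finset.mul_sum]
    refine Finset.sum_congr rfl fun x hx => ?_
    rw [fischer_zonal _ _ _ (zonal_mem_Harm (hX y hy) n), eval_zonal _ (hX x hx)]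
  have h0 := fischer_self_nonneg S
  rw [h] at h0
  exact nonneg_of_mul_nonneg_right h0 (by positivity)

theorem sum_chebyshevU_eq_zero (hX : ∀ x ∈ X, ∑ i, x i ^ 2 = 1) {n : ℕ}
    (hn : n ∈ harmonicStrength X) :
    ∑ y ∈ X, ∑ x ∈ X, chebyshevU n (∑ i, y i * x i) = 0 :=
  Finset.sum_eq_zero fun y hy => by
    rw [← hn.2 _ (zonal_mem_Harm (hX y hy) n)]
    exact Finset.sum_congr rfl fun x hx => (eval_zonal _ (hX x hx) n).symm

/-- The linear programming bound for antipodal sets with prescribed harmonic strength. -/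
theorem two_mul_le_mul_card (hne : X.Nonempty)
    (hsphere : (X : Set (EuclideanSpace ℝ (Fin 4))) ⊆ Metric.sphere 0 1) (hanti : IsAntipodal X)
    {f : ℝ → ℝ} (K : Finset ℕ) (a : ℝ) (c : ℕ → ℝ)
    (hf : ∀ t, f t = a + ∑ k ∈ K, c k * chebyshevU k t)
    (hK : ∀ k ∈ K, k ∈ harmonicStrength X ∨ c k ≤ 0)
    (hnn : ∀ t, t ^ 2 ≤ 1 → 0 ≤ f t) (heven : f (-1) = f 1) :
    2 * f 1 ≤ a * X.card := by
  have hX := sum_sq_eq_one hsphere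
  have upper : ∑ y ∈ X, ∑ x ∈ X, f (∑ i, y i * x i) ≤ a * X.card * X.card := by
    have h : ∑ y ∈ X, ∑ x ∈ X, f (∑ i, y i * x i) = a * X.card * X.card +
        ∑ k ∈ K, c k * ∑ y ∈ X, ∑ x ∈ X, chebyshevU k (∑ i, y i * x i) := by
      simp only [hf, Finset.sum_add_distrib, Finset.sum_const, nsmul_eq_mul, Finset.mul_sum]
      congr 1
      · ring
      · exact (Finset.sum_congr rfl fun y _ => Finset.sum_comm).trans Finset.sum_comm
    rw [h]
    refine add_le_of_nonpos_right (Finset.sum_nonpos fun k hk => ?_)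
    rcases hK k hk with hk | hk
    · rw [sum_chebyshevU_eq_zero hX hk, mul_zero]
    · exact mul_nonpos_of_nonpos_of_nonneg hk (sum_chebyshevU_nonneg hX k)
  have lower : X.card * (2 * f 1) ≤ ∑ y ∈ X, ∑ x ∈ X, f (∑ i, y i * x i) := by
    rw [← nsmul_eq_mul]
    refine Finset.card_nsmul_le_sum _ _ _ fun y hy => ?_
    have hyy : ∑ i, y i * y i = 1 := by simpa [sq] using hX y hy
    have hne' : y ≠ -y := fun h => by
      have : ∀ i, y i = 0 := fun i => by
        have := congrArg (fun z : EuclideanSpace ℝ (Fin 4) => z i) h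
        simp only [PiLp.neg_apply] at this
        linarith
      simp [this] at hyy
    calc 2 * f 1 = ∑ x ∈ {y, -y}, f (∑ i, y i * x i) := by
          rw [Finset.sum_pair hne']
          simp only [PiLp.neg_apply, mul_neg, Finset.sum_neg_distrib, hyy, heven]
          ring
      _ ≤ _ := by
          refine Finset.sum_le_sum_of_subset_of_nonneg ?_ fun x hx _ => hnn _ ?_
          · intro z hz
            rcases Finset.mem_insert.1 hz with rfl | hz
            · exact hy
            · rw [Finset.mem_singleton.1 hz]; exact hanti y hy
          · have := Finset.sum_mul_sq_le_sq_mul_sq Finset.univ (fun i => y i) (fun i => x i)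
            rwa [hX y hy, hX x hx, one_mul] at this
  have hpos : (0 : ℝ) < X.card := by exact_mod_cast hne.card_pos
  nlinarith [upper, lower]

end Sphere

/-! ### Explicit test polynomials -/

theorem chebyshevU_zero (t : ℝ) : chebyshevU 0 t = 1 := rfl

theorem chebyshevU_two (t : ℝ) : chebyshevU 2 t = 4 * t ^ 2 - 1 := by
  simp only [chebyshevU]; ring

theorem chebyshevU_four (t : ℝ) : chebyshevU 4 t = 16 * t ^ 4 - 12 * t ^ 2 + 1 := by
  rw [chebyshevU_add_four 0, chebyshevU_zero, chebyshevU_two]; ring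

theorem chebyshevU_six (t : ℝ) : chebyshevU 6 t =
    64 * t ^ 6 - 80 * t ^ 4 + 24 * t ^ 2 - 1 := by
  rw [chebyshevU_add_four 2, chebyshevU_two, chebyshevU_four]; ring

theorem chebyshevU_eight (t : ℝ) : chebyshevU 8 t =
    256 * t ^ 8 - 448 * t ^ 6 + 240 * t ^ 4 - 40 * t ^ 2 + 1 := by
  rw [chebyshevU_add_four 4, chebyshevU_four, chebyshevU_six]; ring

theorem chebyshevU_ten (t : ℝ) : chebyshevU 10 t =
    1024 * t ^ 10 - 2304 * t ^ 8 + 1792 * t ^ 6 - 560 * t ^ 4 + 60 * t ^ 2 - 1 := by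
  rw [chebyshevU_add_four 6, chebyshevU_six, chebyshevU_eight]; ring

theorem chebyshevU_twelve (t : ℝ) : chebyshevU 12 t =
    4096 * t ^ 12 - 11264 * t ^ 10 + 11520 * t ^ 8 - 5376 * t ^ 6 + 1120 * t ^ 4 -
      84 * t ^ 2 + 1 := by
  rw [chebyshevU_add_four 8, chebyshevU_eight, chebyshevU_ten]; ring

theorem chebyshevU_fourteen (t : ℝ) : chebyshevU 14 t =
    16384 * t ^ 14 - 53248 * t ^ 12 + 67584 * t ^ 10 - 42240 * t ^ 8 + 13440 * t ^ 6 -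
      2016 * t ^ 4 + 112 * t ^ 2 - 1 := by
  rw [chebyshevU_add_four 10, chebyshevU_ten, chebyshevU_twelve]; ring

theorem chebyshevU_sixteen (t : ℝ) : chebyshevU 16 t =
    65536 * t ^ 16 - 245760 * t ^ 14 + 372736 * t ^ 12 - 292864 * t ^ 10 + 126720 * t ^ 8 -
      29568 * t ^ 6 + 3360 * t ^ 4 - 144 * t ^ 2 + 1 := by
  rw [chebyshevU_add_four 12, chebyshevU_twelve, chebyshevU_fourteen]; ring

end SphericalDesign

open SphericalDesign

theorem mainTheorem3 (X : Finset (EuclideanSpace ℝ (Fin 4))) (hne : X.Nonempty)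
    (hsphere : (X : Set (EuclideanSpace ℝ (Fin 4))) ⊆ Metric.sphere 0 1)
    (hanti : SphericalDesign.IsAntipodal X) :
    (({10, 4, 2} : Set ℕ) ⊆ SphericalDesign.harmonicStrength X → 24 ≤ X.card) ∧
    (({14, 10, 6, 4, 2} : Set ℕ) ⊆ SphericalDesign.harmonicStrength X → 48 ≤ X.card) ∧
    (({10, 8, 6, 4, 2} : Set ℕ) ⊆ SphericalDesign.harmonicStrength X → 120 ≤ X.card) := by
  refine ⟨fun h => ?_, fun h => ?_, fun h => ?_⟩
  · have := two_mul_le_mul_card hne hsphere hanti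
      -- The zeros 0, ±1/2 are the inner products of the 24-cell other than ±1; the quartic removes
      -- U_8 and U_6.
      (f := fun t => 1024 * (t ^ 2 * (t ^ 2 - 1 / 4) ^ 2 * (t ^ 4 - 7 / 4 * t ^ 2 + 13 / 16)))
      {10, 4, 2} 3 (fun k => if k = 10 then 1 else if k = 4 then 2 else 4)
      (fun t => by
        simp [chebyshevU_ten, chebyshevU_four, chebyshevU_two]
        ring)
      (fun k hk => Or.inl (h (by simpa using hk)))
      (fun t _ => by
        have : 0 ≤ t ^ 4 - 7 / 4 * t ^ 2 + 13 / 16 := by nlinarith [sq_nonneg (t ^ 2 - 7 / 8)]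
        positivity)
      (by norm_num)
    have h24 : (24 : ℝ) ≤ X.card := by norm_num at this; linarith
    exact_mod_cast h24
  · have := two_mul_le_mul_card hne hsphere hanti
      -- Adjoining the dual 24-cell adds the zeros ±1/√2; the quartic removes U_12 and U_8.
      (f := fun t => 49152 * (t ^ 2 * (t ^ 2 - 1 / 4) ^ 2 * (t ^ 2 - 1 / 2) ^ 2 *
        (t ^ 4 - 7 / 4 * t ^ 2 + 37 / 48)))
      {14, 10, 6, 4, 2} 6 (fun k => if k = 14 then 3 else if k = 10 then 4 else
        if k = 6 then 3 else if k = 4 then 5 else 1)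
      (fun t => by
        simp [chebyshevU_fourteen, chebyshevU_ten, chebyshevU_six, chebyshevU_four, chebyshevU_two]
        ring)
      (fun k hk => Or.inl (h (by simpa using hk)))
      (fun t _ => by
        have : 0 ≤ t ^ 4 - 7 / 4 * t ^ 2 + 37 / 48 := by nlinarith [sq_nonneg (t ^ 2 - 7 / 8)]
        positivity)
      (by norm_num)
    have h48 : (48 : ℝ) ≤ X.card := by norm_num at this; linarith
    exact_mod_cast h48
  · have := two_mul_le_mul_card hne hsphere hanti
      -- The zeros 0, ±1/2, (±1±√5)/4 come from the 600-cell. The constant 24/5 removes U_12, and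
      -- U_14, U_16 get negative coefficients.
      (f := fun t => 32768 * (t ^ 2 * (t ^ 2 - 1 / 4) ^ 2 *
        (t ^ 4 - 3 / 4 * t ^ 2 + 1 / 16) ^ 2 * (24 / 5 - 4 * t ^ 2)))
      {16, 14, 10, 8, 6, 4, 2} 24
      (fun k => if k = 16 then -2 else if k = 14 then -22 / 5 else if k = 10 then 84 / 5 else
        if k = 8 then 204 / 5 else if k = 6 then 308 / 5 else if k = 4 then 354 / 5 else 298 / 5)
      (fun t => by
        simp [chebyshevU_sixteen, chebyshevU_fourteen, chebyshevU_ten, chebyshevU_eight,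
          chebyshevU_six, chebyshevU_four, chebyshevU_two]
        ring)
      (fun k hk => by
        simp only [Finset.mem_insert, Finset.mem_singleton] at hk
        rcases hk with rfl | rfl | hk
        · right; norm_num
        · right; norm_num
        · exact Or.inl (h (by simpa using hk)))
      (fun t ht => by
        have : 0 ≤ 24 / 5 - 4 * t ^ 2 := by linarith
        positivity)
      (by norm_num)
    have h120 : (120 : ℝ) ≤ X.card := by norm_num at this; linarith
    exact_mod_cast h120
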